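/- Let $\mathcal V$ be a countably infinite set of variables and let $\mathcal F$ be a signature, i.e. a (possibly infinite) set of function symbols, each with a fixed arity. A term rewrite system (TRS) $\mathcal R$ over $\mathcal F$ is a (possibly infinite) set of rewrite rules $\ell \to r$ between terms $\ell, r \in \mathcal T(\mathcal F,\mathcal V)$ such that $\ell$ is not a variable and every variable of $r$ occurs in $\ell$. Its rewrite relation $\to_{\mathcal R}$ is the closure of the rules under substitutions and contexts, and $\mathcal R$ is confluent if any two terms reachable by $\to_{\mathcal R}^*$ from a common term can be rewritten by $\to_{\mathcal R}^*$ to a common term. The curried signature consists of a fresh binary symbol $\mathsf{Ap}$ and a constant $f_0$ for each $f \in \mathcal F$. For terms over $\mathcal F$ put $\mathsf{Cu}(x) = x$ for variables $x$ and $$\mathsf{Cu}(f(t_1,\dots,t_n)) = \mathsf{Ap}(\cdots\mathsf{Ap}(\mathsf{Ap}(f_0,\mathsf{Cu}(t_1)),\mathsf{Cu}(t_2))\cdots,\mathsf{Cu}(t_n))$$ (with $n$ occurrences of $\mathsf{Ap}$ displayed; in particular $\mathsf{Cu}(f) = f_0$ if $f$ is a constant). The curried version of $\mathcal R$ is the TRS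 $\mathsf{Cu}(\mathcal R) = \{\mathsf{Cu}(\ell) \to \mathsf{Cu}(r) \mid \ell \to r \in \mathcal R\}$ over the curried signature and the variables $\mathcal V$. Theorem. If $\mathcal R$ is confluent, then $\mathsf{Cu}(\mathcal R)$ is confluent. -/

import Mathlib

universe u v w

namespace Rewriting

/-- A rewrite rule `lhs → rhs` over the signature given by the function symbols of `L`
(relation symbols of `L` play no role): `lhs` is not a variable, and every variable of `rhs`
occurs in `lhs`. -/
@[ext]
structure Rule (L : FirstOrder.Language.{u, v}) (V : Type w) where
  lhs : L.Term V
  rhs : L.Term V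
  lhs_ne_var : ∀ x : V, lhs ≠ FirstOrder.Language.Term.var x
  vars_subset : open Classical in (rhs.varFinset : Finset V) ⊆ lhs.varFinset

/-- A term rewrite system over the signature `L` and the variables `V`: an arbitrary
(possibly infinite) set of rewrite rules. -/
abbrev TRS (L : FirstOrder.Language.{u, v}) (V : Type w) := Set (Rule L V)

/-- The rewrite relation of a TRS: an instance of a rule is applied at the root, or a rewrite
step is performed inside one argument. -/
inductive TRS.Step {L : FirstOrder.Language.{u, v}} {V : Type w} (R : TRS L V) :
    L.Term V → L.Term V → Prop
  | root (ρ : Rule L V) (hρ : ρ ∈ R) (σ : V → L.Term V) :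
      TRS.Step R (ρ.lhs.subst σ) (ρ.rhs.subst σ)
  | arg {n : ℕ} (f : L.Functions n) (ts : Fin n → L.Term V) (i : Fin n) (t : L.Term V) :
      TRS.Step R (ts i) t →
      TRS.Step R (FirstOrder.Language.Term.func f ts)
        (FirstOrder.Language.Term.func f (Function.update ts i t))

/-- A relation is confluent if any two elements reachable from a common element
have a common reduct. -/
def Confluent {α : Type*} (r : α → α → Prop) : Prop :=
  ∀ a b c, Relation.ReflTransGen r a b → Relation.ReflTransGen r a c →
    Relation.Join (Relation.ReflTransGen r) b c

/-- A TRS is confluent if its rewrite relation on all terms is. -/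
def TRS.IsConfluent {L : FirstOrder.Language.{u, v}} {V : Type w} (R : TRS L V) : Prop :=
  Confluent R.Step

/-- The symbols of the curried signature, indexed by their arity: a constant `f₀` for every
function symbol `f` (of any arity), and a fresh binary symbol `Ap`. -/
inductive CurriedFunctions (L : FirstOrder.Language.{u, v}) : ℕ → Type u
  | const {n : ℕ} (f : L.Functions n) : CurriedFunctions L 0
  | ap : CurriedFunctions L 2

/-- The curried signature. -/
def curriedLanguage (L : FirstOrder.Language.{u, v}) : FirstOrder.Language.{u, 0} where
  Functions := CurriedFunctions L
  Relations := fun _ => Empty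

section
variable {L : FirstOrder.Language.{u, v}} {V : Type w}

/-- The term `f₀`. -/
def constTerm {n : ℕ} (f : L.Functions n) : (curriedLanguage L).Term V :=
  FirstOrder.Language.Term.func (L := curriedLanguage L) (CurriedFunctions.const f) Fin.elim0

/-- The term `Ap(s, t)`. -/
def apTerm (s t : (curriedLanguage L).Term V) : (curriedLanguage L).Term V :=
  FirstOrder.Language.Term.func (L := curriedLanguage L) CurriedFunctions.ap ![s, t]

/-- Currying of terms: `Cu(x) = x` and
`Cu(f(t₁, …, tₙ)) = Ap(⋯ Ap(Ap(f₀, Cu(t₁)), Cu(t₂)) ⋯, Cu(tₙ))`. -/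
def curryTerm : L.Term V → (curriedLanguage L).Term V
  | .var x => .var x
  | .func (l := n) f ts =>
      Fin.foldl n (fun s i => apTerm s (curryTerm (ts i))) (constTerm f)

theorem curryTerm_ne_var {t : L.Term V} (ht : ∀ x : V, t ≠ FirstOrder.Language.Term.var x)
    (x : V) :
    curryTerm t ≠ FirstOrder.Language.Term.var x := by
  cases t with
  | var y => exact absurd rfl (ht y)
  | @func n f ts =>
    cases n with
    | zero => simp [curryTerm, constTerm]
    | succ n => simp [curryTerm, Fin.foldl_succ_last, apTerm]

open Classical in
theorem varFinset_apTerm (s t : (curriedLanguage L).Term V) :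
    (apTerm s t).varFinset = s.varFinset ∪ t.varFinset := by
  ext x
  simp [apTerm, FirstOrder.Language.Term.varFinset, Fin.exists_fin_two]

open Classical in
theorem varFinset_foldl_apTerm (n : ℕ) (ts : Fin n → (curriedLanguage L).Term V)
    (s : (curriedLanguage L).Term V) :
    (Fin.foldl n (fun s i => apTerm s (ts i)) s).varFinset =
      s.varFinset ∪ Finset.univ.biUnion fun i => (ts i).varFinset := by
  induction n with
  | zero => simp
  | succ n ih =>
    ext x
    simp [Fin.foldl_succ_last, varFinset_apTerm, ih, Fin.exists_fin_succ']

open Classical in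
theorem varFinset_curryTerm (t : L.Term V) : (curryTerm t).varFinset = t.varFinset := by
  induction t with
  | var x => rfl
  | func f ts ih =>
    simp only [curryTerm]
    rw [varFinset_foldl_apTerm]
    ext x
    simp [constTerm, FirstOrder.Language.Term.varFinset, ih]

/-- The curried rule `Cu(ℓ) → Cu(r)`. -/
def Rule.curry (ρ : Rule L V) : Rule (curriedLanguage L) V where
  lhs := curryTerm ρ.lhs
  rhs := curryTerm ρ.rhs
  lhs_ne_var := curryTerm_ne_var ρ.lhs_ne_var
  vars_subset := by
    rw [varFinset_curryTerm, varFinset_curryTerm]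
    exact ρ.vars_subset

/-- The curried version `Cu(R)` of a TRS `R`. -/
def TRS.curry (R : TRS L V) : TRS (curriedLanguage L) V :=
  Rule.curry '' R

end

end Rewriting

/-!
Call a curried term saturated if it is a function symbol applied to exactly as many arguments as its
arity prescribes. Every curried term splits uniquely into a maximal top layer of saturated
applications, which is a term over the original signature, and its maximal unsaturated subterms,
the aliens. A step either is a step of the original system in the top layer or takes place inside an
alien, which may thereby become saturated and merge with the layer above it; the nesting depth of
aliens, the rank, does not increase, and it decreases for an alien that becomes saturated.

Confluence is proved by induction on the rank. The aliens of a term are confluent: as long as such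
an alien `Ap(s, t)` stays unsaturated only `s` and `t` are rewritten, and once it is saturated its
rank has dropped. If moreover no alien can become saturated, replacing every alien by the set of
terms joinable with it turns rewriting into rewriting of the top layer with the original system,
where confluence is available. The general case reduces to this one by rewriting all aliens to terms
whose own aliens cannot become saturated.
-/

namespace Rewriting

open FirstOrder.Language Relation

section AbstractRewriting
variable {α : Type*} {r : α → α → Prop} {a b c : α}

/-- Two elements are joinable if they have a common reduct. -/
abbrev Joinable (r : α → α → Prop) : α → α → Prop := Join (ReflTransGen r)

/-- Confluence at a single element: any two reducts of `a` are joinable. -/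
def ConfluentAt (r : α → α → Prop) (a : α) : Prop :=
  ∀ b c, ReflTransGen r a b → ReflTransGen r a c → Joinable r b c

theorem ConfluentAt.of_normalForm (h : ∀ b, ¬ r a b) : ConfluentAt r a := by
  intro b c hb hc
  rw [reflTransGen_iff_eq h] at hb hc
  subst hb hc
  exact ⟨_, .refl, .refl⟩

theorem ConfluentAt.reduct (ha : ConfluentAt r a) (h : ReflTransGen r a b) : ConfluentAt r b :=
  fun _ _ hc hd => ha _ _ (h.trans hc) (h.trans hd)

theorem ConfluentAt.join_trans (hb : ConfluentAt r b) (hab : Joinable r a b)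
    (hbc : Joinable r b c) : Joinable r a c := by
  obtain ⟨d, had, hbd⟩ := hab
  obtain ⟨e, hbe, hce⟩ := hbc
  obtain ⟨z, hdz, hez⟩ := hb _ _ hbd hbe
  exact ⟨z, had.trans hdz, hce.trans hez⟩

theorem ConfluentAt.exists_common_reduct (ha : ConfluentAt r a) {A : Set α} (hA : A.Finite)
    (hjoin : ∀ b ∈ A, Joinable r a b) :
    ∃ z, ReflTransGen r a z ∧ ∀ b ∈ A, ReflTransGen r b z := by
  induction A, hA using Set.Finite.induction_on with
  | empty => exact ⟨a, .refl, by simp⟩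
  | @insert b A _ _ ih =>
    rw [Set.forall_mem_insert] at hjoin
    obtain ⟨z, haz, hz⟩ := ih hjoin.2
    obtain ⟨d, had, hbd⟩ := hjoin.1
    obtain ⟨y, hzy, hdy⟩ := ha _ _ haz had
    exact ⟨y, haz.trans hzy,
      Set.forall_mem_insert.2 ⟨hbd.trans hdy, fun c hc => (hz c hc).trans hzy⟩⟩

/-- The elements that are joinable with `a`. On the elements at which `r` is confluent, this is a
complete invariant of joinability that does not change under rewriting. -/
def joinClass (r : α → α → Prop) (a : α) : Set α := {b | Joinable r a b}

theorem ConfluentAt.joinClass_eq (ha : ConfluentAt r a) (h : ReflTransGen r a b) :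
    joinClass r b = joinClass r a := by
  ext c
  exact ⟨fun ⟨d, hbd, hcd⟩ => ⟨d, h.trans hbd, hcd⟩, ha.join_trans ⟨b, .refl, h⟩⟩

theorem joinable_of_joinClass_eq (h : joinClass r a = joinClass r b) : Joinable r a b := by
  have hb : b ∈ joinClass r b := ⟨b, .refl, .refl⟩
  rwa [← h] at hb

theorem exists_reduct_of_joinClass [Nonempty α] {A : Set α} (hA : A.Finite)
    (hconf : ∀ a ∈ A, ConfluentAt r a) :
    ∃ z : Set α → α, ∀ a ∈ A, ReflTransGen r a (z (joinClass r a)) := by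
  have hz : ∀ C : Set α, ∃ z, ∀ a ∈ A, joinClass r a = C → ReflTransGen r a z := by
    intro C
    by_cases hC : ∃ a ∈ A, joinClass r a = C
    · obtain ⟨a, ha, rfl⟩ := hC
      obtain ⟨z, -, hz⟩ := (hconf a ha).exists_common_reduct
        (hA.subset (Set.sep_subset A fun b => joinClass r b = joinClass r a))
        fun b hb => joinable_of_joinClass_eq hb.2.symm
      exact ⟨z, fun b hb hba => hz b ⟨hb, hba⟩⟩
    · exact ⟨Classical.arbitrary α, fun a ha haC => absurd ⟨a, ha, haC⟩ hC⟩
  choose z hz using hz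
  exact ⟨z, fun a ha => hz _ a ha rfl⟩

theorem ConfluentAt.of_reduct_map {P : α → Prop} (hP : ∀ {a b}, P a → r a b → P b) {w : α → α}
    (hw : ∀ a, ReflTransGen r a (w a)) (hconf : ∀ {a}, P a → ConfluentAt r (w a))
    (hjoin : ∀ {a b}, P a → r a b → Joinable r (w a) (w b)) (ha : P a) : ConfluentAt r a := by
  have hreduct : ∀ {b}, ReflTransGen r a b → P b ∧ Joinable r (w a) (w b) := by
    intro b hab
    induction hab with
    | refl => exact ⟨ha, w a, .refl, .refl⟩
    | tail _ hbc ih => exact ⟨hP ih.1 hbc, (hconf ih.1).join_trans ih.2 (hjoin ih.1 hbc)⟩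
  intro b c hab hac
  obtain ⟨z, hbz, hcz⟩ := (hconf ha).join_trans (symm (hreduct hab).2) (hreduct hac).2
  exact ⟨z, (hw b).trans hbz, (hw c).trans hcz⟩

end AbstractRewriting

section Terms
variable {L : FirstOrder.Language.{u, v}} {U V W : Type*}

/-- The set of variables of a term. -/
def vars (t : L.Term V) : Set V := open Classical in ↑t.varFinset

@[simp] theorem vars_var (x : V) : vars (.var x : L.Term V) = {x} := by
  simp [vars]

@[simp] theorem vars_func {n : ℕ} (f : L.Functions n) (ts : Fin n → L.Term V) :
    vars (.func f ts) = ⋃ i, vars (ts i) := by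
  simp [vars]

theorem finite_vars (t : L.Term V) : (vars t).Finite := by
  classical exact t.varFinset.finite_toSet

theorem vars_subst (τ : V → L.Term W) (t : L.Term V) :
    vars (t.subst τ) = ⋃ x ∈ vars t, vars (τ x) := by
  induction t with
  | var x => simp [Term.subst]
  | func f ts ih =>
    simp only [Term.subst, vars_func, ih]
    exact (Set.biUnion_iUnion _ _).symm

theorem subst_subst (τ : U → L.Term V) (σ : V → L.Term W) (t : L.Term U) :
    (t.subst τ).subst σ = t.subst fun x => (τ x).subst σ := by
  induction t with
  | var x => rfl
  | func f ts ih => simp only [Term.subst, ih]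

theorem subst_eq_self {τ : V → L.Term V} {t : L.Term V} (h : ∀ x ∈ vars t, τ x = .var x) :
    t.subst τ = t := by
  induction t with
  | var x => exact h x (by simp)
  | func f ts ih =>
    rw [Term.subst]
    exact congrArg _ (funext fun i => ih i fun x hx => h x (by simpa using ⟨i, hx⟩))

theorem exists_subst_subst_eq_self [Infinite V] (p : L.Term W) :
    ∃ (τ : W → L.Term V) (σ : V → L.Term W), ∀ t, vars t ⊆ vars p → (t.subst τ).subst σ = t := by
  have := (finite_vars p).to_subtype
  obtain ⟨e⟩ := nonempty_embedding_nat (vars p)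
  let g : vars p ↪ V := e.trans (Infinite.natEmbedding V)
  refine ⟨Function.extend Subtype.val (fun x => .var (g x)) fun _ => .var (Classical.arbitrary V),
    Function.extend g (fun x => .var x) fun _ => p, fun t ht => ?_⟩
  rw [subst_subst]
  refine subst_eq_self fun x hx => ?_
  rw [Subtype.val_injective.extend_apply _ _ ⟨x, ht hx⟩, Term.subst, g.injective.extend_apply]

/-- The number of symbols of a term. -/
def size : L.Term V → ℕ
  | .var _ => 1
  | .func _ ts => 1 + ∑ i, size (ts i)

end Terms

section OtherVariables
variable {L : FirstOrder.Language.{u, v}} {V : Type w} {W W' : Type*} {R : TRS L V}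

/-- Rewriting by the rules of `R` on terms over an arbitrary type `W` of variables. -/
inductive TRS.StepOver (R : TRS L V) : L.Term W → L.Term W → Prop
  | root (ρ : Rule L V) (hρ : ρ ∈ R) (σ : V → L.Term W) :
      TRS.StepOver R (ρ.lhs.subst σ) (ρ.rhs.subst σ)
  | arg {n : ℕ} (f : L.Functions n) (ts : Fin n → L.Term W) (i : Fin n) (t : L.Term W) :
      TRS.StepOver R (ts i) t → TRS.StepOver R (.func f ts) (.func f (Function.update ts i t))

/-- Reduction by `R` in any number of steps, on terms over an arbitrary type of variables. -/
abbrev TRS.ReducesOver (R : TRS L V) : L.Term W → L.Term W → Prop := ReflTransGen R.StepOver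

theorem TRS.stepOver_eq_step : R.StepOver = R.Step := by
  ext p q
  constructor <;> intro h
  · induction h with
    | root ρ hρ σ => exact .root ρ hρ σ
    | arg f ts i t _ ih => exact .arg f ts i t ih
  · induction h with
    | root ρ hρ σ => exact .root ρ hρ σ
    | arg f ts i t _ ih => exact .arg f ts i t ih

theorem TRS.StepOver.subst (τ : W → L.Term W') {p q : L.Term W} (h : R.StepOver p q) :
    R.StepOver (p.subst τ) (q.subst τ) := by
  induction h with
  | root ρ hρ σ => simpa only [subst_subst] using StepOver.root ρ hρ fun x => (σ x).subst τ
  | arg f ts i t _ ih =>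
    have := StepOver.arg f (fun j => (ts j).subst τ) i _ ih
    rwa [← Function.comp_def (Term.subst · τ), ← Function.comp_update] at this

theorem TRS.StepOver.vars_subset {p q : L.Term W} (h : R.StepOver p q) : vars q ⊆ vars p := by
  induction h with
  | root ρ hρ σ =>
    rw [vars_subst, vars_subst]
    exact Set.biUnion_subset_biUnion_left fun x hx => ρ.vars_subset hx
  | arg f ts i t _ ih =>
    simp only [vars_func, Set.iUnion_subset_iff]
    intro j
    obtain rfl | hj := eq_or_ne j i
    · rw [Function.update_self]
      exact ih.trans (Set.subset_iUnion (fun j => vars (ts j)) j)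
    · rw [Function.update_of_ne hj]
      exact Set.subset_iUnion (fun j => vars (ts j)) j

theorem TRS.ReducesOver.vars_subset {p q : L.Term W} (h : R.ReducesOver p q) :
    vars q ⊆ vars p := by
  induction h with
  | refl => exact subset_rfl
  | tail _ h ih => exact h.vars_subset.trans ih

theorem TRS.ReducesOver.subst (τ : W → L.Term W') {p q : L.Term W} (h : R.ReducesOver p q) :
    R.ReducesOver (p.subst τ) (q.subst τ) :=
  h.lift (fun t => t.subst τ) fun _ _ hpq => hpq.subst τ

theorem TRS.ReducesOver.func_update {n : ℕ} (f : L.Functions n) (ts : Fin n → L.Term W)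
    (i : Fin n) {t : L.Term W} (h : R.ReducesOver (ts i) t) :
    R.ReducesOver (.func f ts) (.func f (Function.update ts i t)) := by
  induction h with
  | refl => rw [Function.update_eq_self]
  | @tail u t _ h ih =>
    have := StepOver.arg f (Function.update ts i u) i t (by rwa [Function.update_self])
    rw [Function.update_idem] at this
    exact ih.tail this

theorem TRS.IsConfluent.stepOver [Infinite V] (hR : R.IsConfluent) :
    Confluent (R.StepOver (W := W)) := by
  intro p q₁ q₂ h₁ h₂
  obtain ⟨τ, σ, hσ⟩ := exists_subst_subst_eq_self (V := V) p
  rw [TRS.IsConfluent, ← stepOver_eq_step] at hR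
  obtain ⟨d, hd₁, hd₂⟩ := hR _ _ _ (ReducesOver.subst τ h₁) (ReducesOver.subst τ h₂)
  have hd₁' := ReducesOver.subst σ hd₁
  have hd₂' := ReducesOver.subst σ hd₂
  rw [hσ _ (ReducesOver.vars_subset h₁)] at hd₁'
  rw [hσ _ (ReducesOver.vars_subset h₂)] at hd₂'
  exact ⟨d.subst σ, hd₁', hd₂'⟩

end OtherVariables

section CurriedTerms
variable {L : FirstOrder.Language.{u, v}} {V W : Type*}

/-- Terms over the curried signature. -/
abbrev CurriedTerm (L : FirstOrder.Language.{u, v}) (V : Type*) := (curriedLanguage L).Term V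

theorem func_ap (ts : Fin 2 → CurriedTerm L V) :
    Term.func (L := curriedLanguage L) CurriedFunctions.ap ts = apTerm (ts 0) (ts 1) :=
  congrArg _ (List.ofFn_inj.1 rfl)

theorem func_const {n : ℕ} (f : L.Functions n) (ts : Fin 0 → CurriedTerm L V) :
    Term.func (L := curriedLanguage L) (CurriedFunctions.const f) ts = constTerm f :=
  congrArg _ (Subsingleton.elim _ _)

@[elab_as_elim]
theorem CurriedTerm.induction {P : CurriedTerm L V → Prop} (var : ∀ x, P (.var x))
    (const : ∀ {n : ℕ} (f : L.Functions n), P (constTerm f))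
    (ap : ∀ s t, P s → P t → P (apTerm s t)) (t : CurriedTerm L V) : P t := by
  induction t with
  | var x => exact var x
  | func g ts ih =>
    cases g with
    | const f => exact (func_const f ts).symm ▸ const f
    | ap => exact (func_ap ts).symm ▸ ap _ _ (ih 0) (ih 1)

theorem apTerm_inj {s t s' t' : CurriedTerm L V} :
    apTerm s t = apTerm s' t' ↔ s = s' ∧ t = t' := by
  refine ⟨fun h => ?_, fun ⟨hs, ht⟩ => by rw [hs, ht]⟩
  have hargs : (![s, t] : Fin 2 → CurriedTerm L V) = ![s', t'] := eq_of_heq (Term.func.inj h).2.2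
  exact ⟨congrFun hargs 0, congrFun hargs 1⟩

theorem constTerm_ne_apTerm {n : ℕ} (f : L.Functions n) (s t : CurriedTerm L V) :
    constTerm f ≠ apTerm s t :=
  fun h => absurd (Term.func.inj h).1 (by decide)

theorem size_apTerm (s t : CurriedTerm L V) : size (apTerm s t) = 1 + (size s + size t) :=
  congrArg (1 + ·) (Fin.sum_univ_two _)

theorem subst_apTerm (σ : V → CurriedTerm L W) (s t : CurriedTerm L V) :
    (apTerm s t).subst σ = apTerm (s.subst σ) (t.subst σ) :=
  func_ap _

/-- `apps f ts` is the constant `f₀` applied to the arguments `ts`, whose number may differ from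
the arity of `f`. -/
def apps {n : ℕ} (f : L.Functions n) {k : ℕ} (ts : Fin k → CurriedTerm L V) : CurriedTerm L V :=
  Fin.foldl k (fun s i => apTerm s (ts i)) (constTerm f)

theorem apps_zero {n : ℕ} (f : L.Functions n) (ts : Fin 0 → CurriedTerm L V) :
    apps f ts = constTerm f :=
  Fin.foldl_zero _ _

theorem apps_succ {n : ℕ} (f : L.Functions n) {k : ℕ} (ts : Fin (k + 1) → CurriedTerm L V) :
    apps f ts = apTerm (apps f (Fin.init ts)) (ts (Fin.last k)) :=
  Fin.foldl_succ_last _ _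

theorem subst_apps (σ : V → CurriedTerm L W) {n : ℕ} (f : L.Functions n) {k : ℕ}
    (ts : Fin k → CurriedTerm L V) : (apps f ts).subst σ = apps f fun i => (ts i).subst σ := by
  induction k with
  | zero => rw [apps_zero, apps_zero]; exact func_const f _
  | succ k ih => rw [apps_succ, apps_succ, subst_apTerm, ih]; rfl

theorem apps_injective : Function.Injective
    fun p : (Σ n, L.Functions n) × (Σ k, Fin k → CurriedTerm L V) => apps p.1.2 p.2.2 := by
  rintro ⟨⟨n, f⟩, k, ts⟩ ⟨⟨m, g⟩, j, us⟩ h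
  dsimp only at h
  induction k generalizing j with
  | zero =>
    cases j with
    | zero =>
      rw [apps_zero, apps_zero] at h
      have hfg : (CurriedFunctions.const f : CurriedFunctions L 0) = .const g :=
        eq_of_heq (Term.func.inj h).2.1
      cases hfg
      rw [Subsingleton.elim ts us]
    | succ j => rw [apps_zero, apps_succ] at h; exact absurd h (constTerm_ne_apTerm _ _ _)
  | succ k ih =>
    cases j with
    | zero => rw [apps_zero, apps_succ] at h; exact absurd h.symm (constTerm_ne_apTerm _ _ _)
    | succ j =>
      rw [apps_succ, apps_succ, apTerm_inj] at h
      obtain ⟨hinit, hlast⟩ := h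
      have hp := ih _ _ _ hinit
      simp only [Prod.mk.injEq, Sigma.mk.injEq] at hp
      obtain ⟨⟨rfl, hfg⟩, rfl, hinit⟩ := hp
      rw [← Fin.snoc_init_self ts, ← Fin.snoc_init_self us, eq_of_heq hfg, eq_of_heq hinit, hlast]

/-- A curried term is saturated if it is a function symbol applied to exactly as many arguments
as its arity prescribes. -/
def IsSaturated (t : CurriedTerm L V) : Prop :=
  ∃ p : Σ n, L.Functions n × (Fin n → CurriedTerm L V), t = apps p.2.1 p.2.2

theorem isSaturated_apps {n : ℕ} (f : L.Functions n) (ts : Fin n → CurriedTerm L V) :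
    IsSaturated (apps f ts) :=
  ⟨⟨n, f, ts⟩, rfl⟩

theorem not_isSaturated_apps {n : ℕ} (f : L.Functions n) {k : ℕ} (ts : Fin k → CurriedTerm L V)
    (h : k < n) : ¬ IsSaturated (apps f ts) := by
  rintro ⟨⟨m, g, us⟩, e⟩
  have hp := apps_injective (a₁ := (⟨n, f⟩, ⟨k, ts⟩)) (a₂ := (⟨m, g⟩, ⟨m, us⟩)) e
  simp only [Prod.mk.injEq, Sigma.mk.injEq] at hp
  omega

theorem size_lt_size_apps {n : ℕ} (f : L.Functions n) {k : ℕ} (ts : Fin k → CurriedTerm L V)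
    (i : Fin k) : size (ts i) < size (apps f ts) := by
  induction k with
  | zero => exact i.elim0
  | succ k ih =>
    rw [apps_succ, size_apTerm]
    induction i using Fin.lastCases with
    | last => omega
    | cast i => have := ih (Fin.init ts) i; simp only [Fin.init] at this ⊢; omega

@[elab_as_elim]
theorem CurriedTerm.layerInduction {P : CurriedTerm L V → Prop}
    (alien : ∀ a, ¬ IsSaturated a → P a)
    (saturated : ∀ {n : ℕ} (f : L.Functions n) (ts : Fin n → CurriedTerm L V),
      (∀ i, P (ts i)) → P (apps f ts)) (t : CurriedTerm L V) : P t := by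
  induction h : size t using Nat.strong_induction_on generalizing t with
  | _ n ih =>
    subst h
    by_cases ht : IsSaturated t
    · obtain ⟨⟨n, f, ts⟩, rfl⟩ := ht
      exact saturated f ts fun i => ih _ (size_lt_size_apps f ts i) _ rfl
    · exact alien t ht

open Classical in
/-- The maximal saturated top layer of a curried term, as an uncurried term whose variables are
the maximal unsaturated subterms. -/
noncomputable def top (t : CurriedTerm L V) : L.Term (CurriedTerm L V) :=
  if h : IsSaturated t then .func h.choose.2.1 fun i => top (h.choose.2.2 i) else .var t
termination_by size t
decreasing_by exact (size_lt_size_apps _ _ i).trans_eq (congrArg size h.choose_spec).symm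

theorem top_apps {n : ℕ} (f : L.Functions n) (ts : Fin n → CurriedTerm L V) :
    top (apps f ts) = .func f fun i => top (ts i) := by
  have h := isSaturated_apps f ts
  rw [top, dif_pos h]
  have hchoose : h.choose = ⟨n, f, ts⟩ := by
    have hp := h.choose_spec
    generalize h.choose = p at hp
    cases apps_injective (a₁ := (⟨n, f⟩, ⟨n, ts⟩)) (a₂ := (⟨p.1, p.2.1⟩, ⟨p.1, p.2.2⟩)) hp
    rfl
  rw [hchoose]

theorem top_of_not_isSaturated {t : CurriedTerm L V} (h : ¬ IsSaturated t) : top t = .var t := by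
  rw [top, dif_neg h]

/-- The curried version of `l`, instantiated by a substitution of curried terms. -/
def fill (σ : W → CurriedTerm L V) (l : L.Term W) : CurriedTerm L V :=
  (curryTerm l).subst σ

@[simp] theorem fill_var (σ : W → CurriedTerm L V) (x : W) : fill σ (.var x) = σ x := by
  simp [fill, curryTerm, Term.subst]

@[simp] theorem fill_func (σ : W → CurriedTerm L V) {n : ℕ} (f : L.Functions n)
    (ts : Fin n → L.Term W) : fill σ (.func f ts) = apps f fun i => fill σ (ts i) := by
  rw [fill, curryTerm]
  exact subst_apps σ f fun i => curryTerm (ts i)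

theorem fill_subst {W' : Type*} (σ : W' → CurriedTerm L V) (τ : W → L.Term W') (l : L.Term W) :
    fill σ (l.subst τ) = fill (fun x => fill σ (τ x)) l := by
  induction l with
  | var x => simp [Term.subst]
  | func f ts ih => simp [Term.subst, ih]

theorem isSaturated_fill {l : L.Term W} (hl : ∀ x, l ≠ .var x) (σ : W → CurriedTerm L V) :
    IsSaturated (fill σ l) := by
  cases l with
  | var x => exact absurd rfl (hl x)
  | func f ts => rw [fill_func]; exact isSaturated_apps _ _

theorem top_fill (σ : W → CurriedTerm L V) (l : L.Term W) :
    top (fill σ l) = l.subst fun x => top (σ x) := by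
  induction l with
  | var x => simp [Term.subst]
  | func f ts ih => simp [Term.subst, ih, top_apps]

theorem fill_id_top (t : CurriedTerm L V) : fill id (top t) = t := by
  induction t using CurriedTerm.layerInduction with
  | alien a ha => rw [top_of_not_isSaturated ha, fill_var, id]
  | saturated f ts ih => simp [top_apps, ih]

/-- The aliens of a curried term are its maximal unsaturated subterms. -/
def aliens (t : CurriedTerm L V) : Set (CurriedTerm L V) := vars (top t)

theorem finite_aliens (t : CurriedTerm L V) : (aliens t).Finite :=
  finite_vars (top t)

theorem aliens_fill (σ : W → CurriedTerm L V) (l : L.Term W) :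
    aliens (fill σ l) = ⋃ x ∈ vars l, aliens (σ x) := by
  rw [aliens, top_fill, vars_subst]
  rfl

theorem aliens_apps {n : ℕ} (f : L.Functions n) (ts : Fin n → CurriedTerm L V) :
    aliens (apps f ts) = ⋃ i, aliens (ts i) := by
  rw [aliens, top_apps, vars_func]
  rfl

theorem aliens_of_not_isSaturated {a : CurriedTerm L V} (ha : ¬ IsSaturated a) :
    aliens a = {a} := by
  rw [aliens, top_of_not_isSaturated ha, vars_var]

theorem not_isSaturated_of_mem_aliens {t a : CurriedTerm L V} (h : a ∈ aliens t) :
    ¬ IsSaturated a := by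
  induction t using CurriedTerm.layerInduction with
  | alien b hb => rw [aliens_of_not_isSaturated hb] at h; rwa [h]
  | saturated f ts ih =>
    rw [aliens_apps, Set.mem_iUnion] at h
    obtain ⟨i, hi⟩ := h
    exact ih i hi

theorem aliens_fill_rhs_subset {V : Type w} (ρ : Rule L V) (σ : V → CurriedTerm L W) :
    aliens (fill σ ρ.rhs) ⊆ aliens (fill σ ρ.lhs) := by
  rw [aliens_fill, aliens_fill]
  exact Set.biUnion_subset_biUnion_left fun x hx => ρ.vars_subset hx

/-- The result of replacing every alien `a` of a curried term by `w a`. -/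
noncomputable def replaceAliens (w : CurriedTerm L V → CurriedTerm L V) (t : CurriedTerm L V) :
    CurriedTerm L V :=
  fill w (top t)

theorem replaceAliens_fill (w : CurriedTerm L V → CurriedTerm L V) (σ : W → CurriedTerm L V)
    (l : L.Term W) : replaceAliens w (fill σ l) = fill (fun x => replaceAliens w (σ x)) l := by
  simp only [replaceAliens, top_fill, fill_subst]

theorem replaceAliens_apps (w : CurriedTerm L V → CurriedTerm L V) {n : ℕ} (f : L.Functions n)
    (ts : Fin n → CurriedTerm L V) :
    replaceAliens w (apps f ts) = apps f fun i => replaceAliens w (ts i) := by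
  simp only [replaceAliens, top_apps, fill_func]

theorem aliens_replaceAliens (w : CurriedTerm L V → CurriedTerm L V) (t : CurriedTerm L V) :
    aliens (replaceAliens w t) = ⋃ a ∈ aliens t, aliens (w a) :=
  aliens_fill w (top t)

end CurriedTerms

section CurriedSteps
variable {L : FirstOrder.Language.{u, v}} {V : Type w} {W : Type*} {R : TRS L V}

/-- Reduction by `R` in any number of steps. -/
abbrev TRS.Reduces (R : TRS L V) : L.Term V → L.Term V → Prop := ReflTransGen R.Step

/-- A step of the curried system that applies the curried version of a rule of `R` at the root. -/
def TRS.CurryRootStep (R : TRS L V) (s t : CurriedTerm L V) : Prop :=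
  ∃ ρ ∈ R, ∃ σ, s = fill σ ρ.lhs ∧ t = fill σ ρ.rhs

theorem TRS.CurryRootStep.isSaturated {s t : CurriedTerm L V} (h : R.CurryRootStep s t) :
    IsSaturated s := by
  obtain ⟨ρ, -, σ, rfl, -⟩ := h
  exact isSaturated_fill ρ.lhs_ne_var σ

theorem curry_step_fill {ρ : Rule L V} (hρ : ρ ∈ R) (σ : V → CurriedTerm L V) :
    R.curry.Step (fill σ ρ.lhs) (fill σ ρ.rhs) :=
  .root ρ.curry (Set.mem_image_of_mem Rule.curry hρ) σ

theorem curry_step_apTerm_left {s s' : CurriedTerm L V} (h : R.curry.Step s s')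
    (t : CurriedTerm L V) : R.curry.Step (apTerm s t) (apTerm s' t) := by
  have := TRS.Step.arg (R := R.curry) CurriedFunctions.ap ![s, t] 0 s' h
  rwa [func_ap, func_ap] at this

theorem curry_step_apTerm_right (s : CurriedTerm L V) {t t' : CurriedTerm L V}
    (h : R.curry.Step t t') : R.curry.Step (apTerm s t) (apTerm s t') := by
  have := TRS.Step.arg (R := R.curry) CurriedFunctions.ap ![s, t] 1 t' h
  rwa [func_ap, func_ap] at this

theorem curry_step_cases {s t : CurriedTerm L V} (h : R.curry.Step s t) :
    R.CurryRootStep s t ∨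
      (∃ p p' q, R.curry.Step p p' ∧ s = apTerm p q ∧ t = apTerm p' q) ∨
      ∃ p q q', R.curry.Step q q' ∧ s = apTerm p q ∧ t = apTerm p q' := by
  cases h with
  | root ρ hρ σ =>
    obtain ⟨ρ, hρ, rfl⟩ := hρ
    exact .inl ⟨ρ, hρ, σ, rfl, rfl⟩
  | arg g ts i t h =>
    cases g with
    | const f => exact i.elim0
    | ap =>
      rw [func_ap, func_ap]
      match i with
      | 0 => exact .inr (.inl ⟨_, t, _, h, rfl, rfl⟩)
      | 1 => exact .inr (.inr ⟨_, _, t, h, rfl, rfl⟩)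

theorem curry_step_apTerm {p q b : CurriedTerm L V} (h : R.curry.Step (apTerm p q) b) :
    R.CurryRootStep (apTerm p q) b ∨ (∃ p', R.curry.Step p p' ∧ b = apTerm p' q) ∨
      ∃ q', R.curry.Step q q' ∧ b = apTerm p q' := by
  rcases curry_step_cases h with h | ⟨p', p'', q', hp, e, rfl⟩ | ⟨p', q', q'', hq, e, rfl⟩
  · exact .inl h
  · obtain ⟨rfl, rfl⟩ := apTerm_inj.1 e
    exact .inr (.inl ⟨p'', hp, rfl⟩)
  · obtain ⟨rfl, rfl⟩ := apTerm_inj.1 e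
    exact .inr (.inr ⟨q'', hq, rfl⟩)

theorem exists_apTerm_of_step {a b : CurriedTerm L V} (ha : ¬ IsSaturated a)
    (h : R.curry.Step a b) : ∃ s t s' t', a = apTerm s t ∧ b = apTerm s' t' ∧
      R.curry.Reduces s s' ∧ R.curry.Reduces t t' := by
  rcases curry_step_cases h with h | ⟨s, s', t, hs, rfl, rfl⟩ | ⟨s, t, t', ht, rfl, rfl⟩
  · exact absurd h.isSaturated ha
  · exact ⟨s, t, s', t, rfl, rfl, .single hs, .refl⟩
  · exact ⟨s, t, s, t', rfl, rfl, .refl, .single ht⟩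

theorem curry_step_apps {n : ℕ} {f : L.Functions n} {k : ℕ} (hk : k ≤ n)
    {ts : Fin k → CurriedTerm L V} {b : CurriedTerm L V} (h : R.curry.Step (apps f ts) b) :
    R.CurryRootStep (apps f ts) b ∨
      ∃ i t, R.curry.Step (ts i) t ∧ b = apps f (Function.update ts i t) := by
  induction k generalizing b with
  | zero =>
    rw [apps_zero] at h ⊢
    rcases curry_step_cases h with h | ⟨_, _, _, _, e, _⟩ | ⟨_, _, _, _, e, _⟩
    · exact .inl h
    · exact absurd e (constTerm_ne_apTerm _ _ _)
    · exact absurd e (constTerm_ne_apTerm _ _ _)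
  | succ k ih =>
    rw [apps_succ] at h ⊢
    rcases curry_step_apTerm h with h | ⟨s, hs, rfl⟩ | ⟨t, ht, rfl⟩
    · exact .inl h
    · rcases ih (Nat.le_of_succ_le hk) hs with hroot | ⟨i, t, ht, rfl⟩
      · exact absurd hroot.isSaturated (not_isSaturated_apps f _ hk)
      · refine .inr ⟨i.castSucc, t, ht, ?_⟩
        rw [apps_succ, Fin.init_update_castSucc,
          Function.update_of_ne (Fin.castSucc_ne_last i).symm]
    · refine .inr ⟨Fin.last k, t, ht, ?_⟩
      rw [apps_succ, Fin.init_update_last, Function.update_self]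

@[elab_as_elim]
theorem curry_step_layerInduction {P : CurriedTerm L V → CurriedTerm L V → Prop}
    (alien : ∀ a b, ¬ IsSaturated a → R.curry.Step a b → P a b)
    (root : ∀ ρ ∈ R, ∀ σ, P (fill σ ρ.lhs) (fill σ ρ.rhs))
    (arg : ∀ {n : ℕ} (f : L.Functions n) (ts : Fin n → CurriedTerm L V) (i : Fin n)
      (t : CurriedTerm L V), P (ts i) t → P (apps f ts) (apps f (Function.update ts i t)))
    {s t : CurriedTerm L V} (h : R.curry.Step s t) : P s t := by
  induction s using CurriedTerm.layerInduction generalizing t with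
  | alien a ha => exact alien a t ha h
  | saturated f ts ih =>
    rcases curry_step_apps le_rfl h with ⟨ρ, hρ, σ, e, rfl⟩ | ⟨i, t, hi, rfl⟩
    · exact e ▸ root ρ hρ σ
    · exact arg f ts i t (ih i hi)

theorem reduces_apTerm {s s' t t' : CurriedTerm L V} (hs : R.curry.Reduces s s')
    (ht : R.curry.Reduces t t') : R.curry.Reduces (apTerm s t) (apTerm s' t') :=
  (hs.lift (apTerm · t) fun _ _ h => curry_step_apTerm_left h t).trans
    (ht.lift (apTerm s') fun _ _ h => curry_step_apTerm_right s' h)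

theorem reduces_apps {n : ℕ} (f : L.Functions n) {k : ℕ} {ts us : Fin k → CurriedTerm L V}
    (h : ∀ i, R.curry.Reduces (ts i) (us i)) : R.curry.Reduces (apps f ts) (apps f us) := by
  induction k with
  | zero => rw [Subsingleton.elim ts us]
  | succ k ih =>
    rw [apps_succ, apps_succ]
    exact reduces_apTerm (ih fun i => h i.castSucc) (h _)

theorem joinable_apps {n : ℕ} (f : L.Functions n) {k : ℕ} {ts us : Fin k → CurriedTerm L V}
    (h : ∀ i, Joinable R.curry.Step (ts i) (us i)) :
    Joinable R.curry.Step (apps f ts) (apps f us) := by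
  choose ds hts hus using h
  exact ⟨apps f ds, reduces_apps f hts, reduces_apps f hus⟩

theorem reduces_apps_update {n : ℕ} (f : L.Functions n) {k : ℕ} (ts : Fin k → CurriedTerm L V)
    {i : Fin k} {t : CurriedTerm L V} (h : R.curry.Reduces (ts i) t) :
    R.curry.Reduces (apps f ts) (apps f (Function.update ts i t)) := by
  refine reduces_apps f fun j => ?_
  obtain rfl | hj := eq_or_ne j i
  · rwa [Function.update_self]
  · rw [Function.update_of_ne hj]

theorem reduces_fill {σ τ : W → CurriedTerm L V} {l : L.Term W}
    (h : ∀ x ∈ vars l, R.curry.Reduces (σ x) (τ x)) : R.curry.Reduces (fill σ l) (fill τ l) := by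
  induction l with
  | var x => simpa using h
  | func f ts ih =>
    rw [fill_func, fill_func]
    exact reduces_apps f fun i => ih i fun x hx => h x (by simpa using ⟨i, hx⟩)

theorem reduces_fill_of_stepOver (σ : W → CurriedTerm L V) {p q : L.Term W}
    (h : R.StepOver p q) : R.curry.Reduces (fill σ p) (fill σ q) := by
  induction h with
  | root ρ hρ τ =>
    rw [fill_subst, fill_subst]
    exact .single (curry_step_fill hρ _)
  | arg f ts i t _ ih =>
    rw [fill_func, fill_func]
    have := reduces_apps_update f (fun j => fill σ (ts j)) ih
    rwa [← Function.comp_def (fill σ), ← Function.comp_update] at this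

theorem reduces_fill_of_reducesOver (σ : W → CurriedTerm L V) {p q : L.Term W}
    (h : R.ReducesOver p q) : R.curry.Reduces (fill σ p) (fill σ q) :=
  ReflTransGen.lift' (fill σ) (fun _ _ => reduces_fill_of_stepOver σ) _ _ h

theorem reduces_replaceAliens {w : CurriedTerm L V → CurriedTerm L V} {t : CurriedTerm L V}
    (hw : ∀ a ∈ aliens t, R.curry.Reduces a (w a)) : R.curry.Reduces t (replaceAliens w t) := by
  have := reduces_fill (σ := id) hw
  rwa [fill_id_top] at this

theorem mem_aliens_of_step {s t b : CurriedTerm L V} (h : R.curry.Step s t) (hb : b ∈ aliens t) :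
    b ∈ aliens s ∨ ∃ a ∈ aliens s, ∃ a', R.curry.Step a a' ∧ b ∈ aliens a' := by
  revert hb
  refine curry_step_layerInduction ?alien ?root ?arg h
  case alien =>
    intro a a' ha haa' hb
    exact .inr ⟨a, by rw [aliens_of_not_isSaturated ha]; rfl, a', haa', hb⟩
  case root => exact fun ρ _ σ hb => .inl (aliens_fill_rhs_subset ρ σ hb)
  case arg =>
    intro n f ts i t ih hb
    simp only [aliens_apps, Set.mem_iUnion] at hb ⊢
    obtain ⟨j, hj⟩ := hb
    obtain rfl | hji := eq_or_ne j i
    · rw [Function.update_self] at hj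
      rcases ih hj with hs | ⟨a, ha, haa'⟩
      · exact .inl ⟨j, hs⟩
      · exact .inr ⟨a, ⟨j, ha⟩, haa'⟩
    · rw [Function.update_of_ne hji] at hj
      exact .inl ⟨j, hj⟩

theorem exists_apTerm_of_reduces {s t b : CurriedTerm L V} (h : R.curry.Reduces (apTerm s t) b) :
    ∃ s' t', R.curry.Reduces s s' ∧ R.curry.Reduces t t' ∧ R.curry.Reduces (apTerm s' t') b ∧
      (b = apTerm s' t' ∨ IsSaturated (apTerm s' t')) := by
  induction h with
  | refl => exact ⟨s, t, .refl, .refl, .refl, .inl rfl⟩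
  | tail _ hbc ih =>
    obtain ⟨s', t', hs, ht, hb, rfl | hsat⟩ := ih
    · by_cases hsat : IsSaturated (apTerm s' t')
      · exact ⟨s', t', hs, ht, .single hbc, .inr hsat⟩
      · obtain ⟨p, q, s'', t'', e, rfl, hp, hq⟩ := exists_apTerm_of_step hsat hbc
        obtain ⟨rfl, rfl⟩ := apTerm_inj.1 e
        exact ⟨s'', t'', hs.trans hp, ht.trans hq, .refl, .inl rfl⟩
    · exact ⟨s', t', hs, ht, hb.tail hbc, .inr hsat⟩

theorem confluentAt_apTerm {s t : CurriedTerm L V} (hs : ConfluentAt R.curry.Step s)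
    (ht : ConfluentAt R.curry.Step t)
    (hsat : ∀ s' t', R.curry.Reduces s s' → R.curry.Reduces t t' → IsSaturated (apTerm s' t') →
      ConfluentAt R.curry.Step (apTerm s' t')) :
    ConfluentAt R.curry.Step (apTerm s t) := by
  intro b c hb hc
  obtain ⟨s₁, t₁, hs₁, ht₁, hb, hb'⟩ := exists_apTerm_of_reduces hb
  obtain ⟨s₂, t₂, hs₂, ht₂, hc, hc'⟩ := exists_apTerm_of_reduces hc
  obtain ⟨s', hs₁', hs₂'⟩ := hs _ _ hs₁ hs₂
  obtain ⟨t', ht₁', ht₂'⟩ := ht _ _ ht₁ ht₂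
  have hbz : ∃ z, R.curry.Reduces b z ∧ R.curry.Reduces (apTerm s' t') z := by
    rcases hb' with rfl | hsat₁
    · exact ⟨_, reduces_apTerm hs₁' ht₁', .refl⟩
    · exact hsat s₁ t₁ hs₁ ht₁ hsat₁ _ _ hb (reduces_apTerm hs₁' ht₁')
  obtain ⟨z, hbz, hz⟩ := hbz
  have hz : R.curry.Reduces (apTerm s₂ t₂) z := (reduces_apTerm hs₂' ht₂').trans hz
  rcases hc' with rfl | hsat₂
  · exact ⟨z, hbz, hz⟩
  · obtain ⟨y, hzy, hcy⟩ := hsat s₂ t₂ hs₂ ht₂ hsat₂ _ _ hz hc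
    exact ⟨y, hbz.trans hzy, hcy⟩

end CurriedSteps

section Rank
variable {L : FirstOrder.Language.{u, v}} {V : Type w} {R : TRS L V} {n : ℕ}

/-- The rank of a curried term, the nesting depth of its aliens, is less than the given number.
Variables and constants have rank `0`. -/
def RankLT : ℕ → CurriedTerm L V → Prop
  | 0, _ => False
  | n + 1, t => ∀ a ∈ aliens t, ∀ s u, a = apTerm s u → RankLT n s ∧ RankLT n u

theorem RankLT.succ {t : CurriedTerm L V} (h : RankLT n t) : RankLT (n + 1) t := by
  induction n generalizing t with
  | zero => exact h.elim
  | succ n ih => exact fun a ha s u e => (h a ha s u e).imp ih ih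

theorem rankLT_succ_iff {t : CurriedTerm L V} :
    RankLT (n + 1) t ↔ ∀ a ∈ aliens t, RankLT (n + 1) a := by
  refine forall₂_congr fun a ha => ?_
  rw [RankLT, aliens_of_not_isSaturated (not_isSaturated_of_mem_aliens ha)]
  simp only [Set.mem_singleton_iff, forall_eq]

theorem rankLT_apTerm_iff {s t : CurriedTerm L V} (h : ¬ IsSaturated (apTerm s t)) :
    RankLT (n + 1) (apTerm s t) ↔ RankLT n s ∧ RankLT n t := by
  rw [RankLT, aliens_of_not_isSaturated h]
  simp only [Set.mem_singleton_iff, forall_eq, apTerm_inj]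
  exact ⟨fun h => h s t ⟨rfl, rfl⟩, by rintro h _ _ ⟨rfl, rfl⟩; exact h⟩

theorem RankLT.of_partial_apps {m k : ℕ} {f : L.Functions m} {ts : Fin k → CurriedTerm L V}
    (hk : k < m) (h : RankLT n (apps f ts)) (i : Fin k) : RankLT n (ts i) := by
  induction k generalizing n with
  | zero => exact i.elim0
  | succ k ih =>
    cases n with
    | zero => exact h.elim
    | succ n =>
      have hsat := not_isSaturated_apps f ts hk
      rw [apps_succ] at h hsat
      obtain ⟨hinit, hlast⟩ := (rankLT_apTerm_iff hsat).1 h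
      induction i using Fin.lastCases with
      | last => exact hlast.succ
      | cast i => exact (ih (Nat.lt_of_succ_lt hk) hinit i).succ

theorem rankLT_apTerm_of_isSaturated {s t : CurriedTerm L V} (h : IsSaturated (apTerm s t))
    (hs : RankLT n s) (ht : RankLT n t) : RankLT n (apTerm s t) := by
  obtain ⟨⟨m, f, ts⟩, e⟩ := h
  cases n with
  | zero => exact hs.elim
  | succ n =>
    cases m with
    | zero => exact absurd (e.trans (apps_zero f ts)).symm (constTerm_ne_apTerm _ _ _)
    | succ m =>
      obtain ⟨rfl, rfl⟩ := apTerm_inj.1 (e.trans (apps_succ f ts))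
      have hts : ∀ i, RankLT (n + 1) (ts i) :=
        Fin.lastCases ht fun i => hs.of_partial_apps m.lt_succ_self i
      rw [← apps_succ, rankLT_succ_iff, aliens_apps]
      intro a ha
      obtain ⟨i, hi⟩ := Set.mem_iUnion.1 ha
      exact rankLT_succ_iff.1 (hts i) a hi

theorem rankLT_apTerm {s t : CurriedTerm L V} (hs : RankLT n s) (ht : RankLT n t) :
    RankLT (n + 1) (apTerm s t) := by
  by_cases h : IsSaturated (apTerm s t)
  · exact (rankLT_apTerm_of_isSaturated h hs ht).succ
  · exact (rankLT_apTerm_iff h).2 ⟨hs, ht⟩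

theorem rankLT_one_of_ne_apTerm {t : CurriedTerm L V} (h : ∀ s u, t ≠ apTerm s u) :
    RankLT 1 t := by
  intro a ha s u e
  by_cases ht : IsSaturated t
  · obtain ⟨⟨m, f, ts⟩, rfl⟩ := ht
    cases m with
    | zero => simp [aliens_apps] at ha
    | succ m => exact absurd (apps_succ f ts) (h _ _)
  · rw [aliens_of_not_isSaturated ht] at ha
    exact absurd (ha.symm.trans e) (h s u)

theorem exists_rankLT (t : CurriedTerm L V) : ∃ n, RankLT n t := by
  induction t using CurriedTerm.induction with
  | var x => exact ⟨1, rankLT_one_of_ne_apTerm fun _ _ => nofun⟩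
  | const f => exact ⟨1, rankLT_one_of_ne_apTerm (constTerm_ne_apTerm f)⟩
  | ap s t hs ht =>
    have hmono : ∀ t : CurriedTerm L V, Monotone fun n => RankLT n t :=
      fun t => monotone_nat_of_le_succ fun _ => RankLT.succ
    obtain ⟨m, hs⟩ := hs
    obtain ⟨n, ht⟩ := ht
    exact ⟨max m n + 1,
      rankLT_apTerm (hmono s (le_max_left m n) hs) (hmono t (le_max_right m n) ht)⟩

theorem RankLT.reduces {s t : CurriedTerm L V} (hs : RankLT n s) (h : R.curry.Reduces s t) :
    RankLT n t := by
  induction n generalizing s t with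
  | zero => exact hs.elim
  | succ n ih =>
    induction h with
    | refl => exact hs
    | tail _ h hs =>
      refine rankLT_succ_iff.2 fun b hb => ?_
      rcases mem_aliens_of_step h hb with hb | ⟨a, ha, a', haa', hb⟩
      · exact rankLT_succ_iff.1 hs b hb
      · obtain ⟨p, q, p', q', rfl, rfl, hp, hq⟩ :=
          exists_apTerm_of_step (not_isSaturated_of_mem_aliens ha) haa'
        obtain ⟨hpn, hqn⟩ := hs _ ha p q rfl
        exact rankLT_succ_iff.1 (rankLT_apTerm (ih hpn hp) (ih hqn hq)) b hb

theorem RankLT.of_reduces_isSaturated {a b : CurriedTerm L V} (ha : RankLT (n + 1) a)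
    (hasat : ¬ IsSaturated a) (h : R.curry.Reduces a b) (hb : IsSaturated b) : RankLT n b := by
  obtain rfl | ⟨a', haa', -⟩ := h.cases_head
  · exact absurd hb hasat
  obtain ⟨s, t, -, -, rfl, -⟩ := exists_apTerm_of_step hasat haa'
  obtain ⟨hs, ht⟩ := (rankLT_apTerm_iff hasat).1 ha
  obtain ⟨s', t', hs', ht', hb', e⟩ := exists_apTerm_of_reduces h
  have hsat : IsSaturated (apTerm s' t') := e.elim (fun e => e ▸ hb) id
  exact (rankLT_apTerm_of_isSaturated hsat (hs.reduces hs') (ht.reduces ht')).reduces hb'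

end Rank

section StableAliens
variable {L : FirstOrder.Language.{u, v}} {V : Type w} {R : TRS L V} {s t : CurriedTerm L V}

/-- No reduct of the curried term `a` is saturated. -/
def TRS.StaysUnsaturated (R : TRS L V) (a : CurriedTerm L V) : Prop :=
  ∀ b, R.curry.Reduces a b → ¬ IsSaturated b

/-- Every alien of `t` is confluent and stays an alien under reduction, so that the layer
structure of `t` is not affected by reduction inside its aliens. -/
def TRS.HasStableAliens (R : TRS L V) (t : CurriedTerm L V) : Prop :=
  ∀ a ∈ aliens t, ConfluentAt R.curry.Step a ∧ R.StaysUnsaturated a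

/-- The top layer of `t`, with every alien represented by a variable that only depends on the
terms it is joinable with. -/
noncomputable def TRS.skeleton (R : TRS L V) (t : CurriedTerm L V) :
    L.Term (Set (CurriedTerm L V)) :=
  (top t).subst fun a => .var (joinClass R.curry.Step a)

theorem skeleton_of_not_isSaturated (h : ¬ IsSaturated t) :
    R.skeleton t = .var (joinClass R.curry.Step t) := by
  rw [TRS.skeleton, top_of_not_isSaturated h, Term.subst]

theorem skeleton_apps {n : ℕ} (f : L.Functions n) (ts : Fin n → CurriedTerm L V) :
    R.skeleton (apps f ts) = .func f fun i => R.skeleton (ts i) := by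
  rw [TRS.skeleton, top_apps, Term.subst]
  rfl

theorem skeleton_fill {W : Type*} (σ : W → CurriedTerm L V) (l : L.Term W) :
    R.skeleton (fill σ l) = l.subst fun x => R.skeleton (σ x) := by
  rw [TRS.skeleton, top_fill, subst_subst]
  rfl

theorem TRS.HasStableAliens.step (hs : R.HasStableAliens s) (h : R.curry.Step s t) :
    R.HasStableAliens t := by
  intro b hb
  rcases mem_aliens_of_step h hb with hb | ⟨a, ha, a', haa', hb⟩
  · exact hs b hb
  · obtain ⟨hconf, hstays⟩ := hs a ha
    rw [aliens_of_not_isSaturated (hstays a' (.single haa'))] at hb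
    obtain rfl := hb
    exact ⟨hconf.reduct (.single haa'), fun c hc => hstays c (.head haa' hc)⟩

theorem TRS.HasStableAliens.skeleton_step (hs : R.HasStableAliens s) (h : R.curry.Step s t) :
    R.ReducesOver (R.skeleton s) (R.skeleton t) := by
  revert hs
  refine curry_step_layerInduction ?alien ?root ?arg h
  case alien =>
    intro a b ha hab hstable
    obtain ⟨hconf, hstays⟩ := hstable a (by rw [aliens_of_not_isSaturated ha]; rfl)
    rw [skeleton_of_not_isSaturated ha, skeleton_of_not_isSaturated (hstays b (.single hab)),
      hconf.joinClass_eq (.single hab)]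
  case root =>
    intro ρ hρ σ _
    rw [skeleton_fill, skeleton_fill]
    exact .single (.root ρ hρ _)
  case arg =>
    intro n f ts i t ih hstable
    have hi : R.HasStableAliens (ts i) :=
      fun a ha => hstable a (by rw [aliens_apps]; exact Set.mem_iUnion_of_mem i ha)
    have := TRS.ReducesOver.func_update f (fun j => R.skeleton (ts j)) i (ih hi)
    rw [skeleton_apps, skeleton_apps]
    rwa [← Function.comp_def R.skeleton, ← Function.comp_update] at this

theorem TRS.HasStableAliens.reduces (hs : R.HasStableAliens s) (h : R.curry.Reduces s t) :
    R.HasStableAliens t ∧ R.ReducesOver (R.skeleton s) (R.skeleton t) := by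
  induction h with
  | refl => exact ⟨hs, .refl⟩
  | tail _ h ih => exact ⟨ih.1.step h, ih.2.trans (ih.1.skeleton_step h)⟩

theorem reduces_fill_skeleton {z : Set (CurriedTerm L V) → CurriedTerm L V}
    (hz : ∀ a ∈ aliens t, R.curry.Reduces a (z (joinClass R.curry.Step a))) :
    R.curry.Reduces t (fill z (R.skeleton t)) := by
  rw [TRS.skeleton, fill_subst]
  simpa only [fill_var, replaceAliens] using reduces_replaceAliens hz

theorem TRS.HasStableAliens.confluentAt [Infinite V] (hR : R.IsConfluent)
    (ht : R.HasStableAliens t) : ConfluentAt R.curry.Step t := by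
  intro b c hb hc
  obtain ⟨hb, hbt⟩ := ht.reduces hb
  obtain ⟨hc, hct⟩ := ht.reduces hc
  obtain ⟨p, hbp, hcp⟩ := hR.stepOver _ _ _ hbt hct
  have : Nonempty (CurriedTerm L V) := ⟨t⟩
  obtain ⟨z, hz⟩ := exists_reduct_of_joinClass ((finite_aliens b).union (finite_aliens c))
    fun a ha => ha.elim (fun ha => (hb a ha).1) fun ha => (hc a ha).1
  exact ⟨fill z p,
    (reduces_fill_skeleton fun a ha => hz a (.inl ha)).trans (reduces_fill_of_reducesOver z hbp),
    (reduces_fill_skeleton fun a ha => hz a (.inr ha)).trans (reduces_fill_of_reducesOver z hcp)⟩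

end StableAliens

section Confluence
variable {L : FirstOrder.Language.{u, v}} {V : Type w} {R : TRS L V} {n : ℕ}

theorem RankLT.exists_reduct_staysUnsaturated {t : CurriedTerm L V} (ht : RankLT n t) :
    ∃ t', R.curry.Reduces t t' ∧ ∀ a ∈ aliens t', R.StaysUnsaturated a := by
  induction n generalizing t with
  | zero => exact ht.elim
  | succ n ih =>
    have halien : ∀ a ∈ aliens t, ∃ a', R.curry.Reduces a a' ∧
        ∀ b ∈ aliens a', R.StaysUnsaturated b := by
      intro a ha
      have hasat := not_isSaturated_of_mem_aliens ha
      by_cases hstays : R.StaysUnsaturated a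
      · refine ⟨a, .refl, ?_⟩
        rw [aliens_of_not_isSaturated hasat]
        exact by rintro _ rfl; exact hstays
      · rw [TRS.StaysUnsaturated] at hstays
        push Not at hstays
        obtain ⟨b, hab, hb⟩ := hstays
        have hbn := (rankLT_succ_iff.1 ht a ha).of_reduces_isSaturated hasat hab hb
        obtain ⟨a', hba', ha'⟩ := ih hbn
        exact ⟨a', hab.trans hba', ha'⟩
    choose! w hw hstays using halien
    refine ⟨replaceAliens w t, reduces_replaceAliens hw, ?_⟩
    rw [aliens_replaceAliens]
    intro b hb
    obtain ⟨a, ha, hb⟩ := Set.mem_iUnion₂.1 hb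
    exact hstays a ha b hb

theorem joinable_replaceAliens_of_step {w : CurriedTerm L V → CurriedTerm L V}
    (hw : ∀ a, R.curry.Reduces a (w a)) {s t : CurriedTerm L V}
    (hs : ∀ a ∈ aliens s, ConfluentAt R.curry.Step a) (h : R.curry.Step s t) :
    Joinable R.curry.Step (replaceAliens w s) (replaceAliens w t) := by
  revert hs
  refine curry_step_layerInduction ?alien ?root ?arg h
  case alien =>
    intro a b ha hab hconf
    rw [replaceAliens, top_of_not_isSaturated ha, fill_var]
    exact hconf a (by rw [aliens_of_not_isSaturated ha]; rfl) _ _ (hw a)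
      (.head hab (reduces_replaceAliens fun c _ => hw c))
  case root =>
    intro ρ hρ σ _
    rw [replaceAliens_fill, replaceAliens_fill]
    exact ⟨_, .single (curry_step_fill hρ _), .refl⟩
  case arg =>
    intro n f ts i t ih hconf
    rw [replaceAliens_apps, replaceAliens_apps]
    refine joinable_apps f fun j => ?_
    obtain rfl | hj := eq_or_ne j i
    · rw [Function.update_self]
      exact ih fun a ha => hconf a (by rw [aliens_apps]; exact Set.mem_iUnion_of_mem j ha)
    · rw [Function.update_of_ne hj]
      exact ⟨_, .refl, .refl⟩

theorem RankLT.confluentAt_of_not_isSaturated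
    (hconf : ∀ t : CurriedTerm L V, RankLT n t → ConfluentAt R.curry.Step t) {a : CurriedTerm L V}
    (ha : RankLT (n + 1) a) (hasat : ¬ IsSaturated a) : ConfluentAt R.curry.Step a := by
  by_cases hnf : ∃ b, R.curry.Step a b
  · obtain ⟨b, hab⟩ := hnf
    obtain ⟨s, t, -, -, rfl, -⟩ := exists_apTerm_of_step hasat hab
    obtain ⟨hs, ht⟩ := (rankLT_apTerm_iff hasat).1 ha
    exact confluentAt_apTerm (hconf s hs) (hconf t ht) fun s' t' hs' ht' hsat =>
      hconf _ (rankLT_apTerm_of_isSaturated hsat (hs.reduces hs') (ht.reduces ht'))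
  · exact .of_normalForm (not_exists.1 hnf)

theorem RankLT.confluentAt [Infinite V] (hR : R.IsConfluent) {t : CurriedTerm L V}
    (ht : RankLT n t) : ConfluentAt R.curry.Step t := by
  induction n generalizing t with
  | zero => exact ht.elim
  | succ n ih =>
    have halien : ∀ {t : CurriedTerm L V}, RankLT (n + 1) t →
        ∀ a ∈ aliens t, ConfluentAt R.curry.Step a := fun ht a ha =>
      (rankLT_succ_iff.1 ht a ha).confluentAt_of_not_isSaturated (fun _ => ih)
        (not_isSaturated_of_mem_aliens ha)
    choose w hw hstays using fun a : CurriedTerm L V =>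
      (exists_rankLT a).choose_spec.exists_reduct_staysUnsaturated (R := R)
    have hreplace : ∀ t, R.curry.Reduces t (replaceAliens w t) :=
      fun t => reduces_replaceAliens fun a _ => hw a
    refine ConfluentAt.of_reduct_map (P := RankLT (n + 1)) (fun hs h => hs.reduces (.single h))
      hreplace (fun {s} hs => ?_) (fun hs h => joinable_replaceAliens_of_step hw (halien hs) h) ht
    refine TRS.HasStableAliens.confluentAt hR fun b hb =>
      ⟨halien (hs.reduces (hreplace s)) b hb, ?_⟩
    rw [aliens_replaceAliens] at hb
    obtain ⟨a, -, hb⟩ := Set.mem_iUnion₂.1 hb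
    exact hstays a b hb

end Confluence

end Rewriting

theorem mainTheorem9_general {L : FirstOrder.Language.{u, v}} {V : Type w} [Infinite V]
    (R : Rewriting.TRS L V) (hR : R.IsConfluent) : R.curry.IsConfluent := by
  intro t
  obtain ⟨n, ht⟩ := Rewriting.exists_rankLT t
  exact ht.confluentAt hR

theorem mainTheorem9 {L : FirstOrder.Language.{u, v}} {V : Type w}
    [Countable V] [Infinite V] (R : Rewriting.TRS L V) (hR : R.IsConfluent) :
    R.curry.IsConfluent :=
  mainTheorem9_general R hR
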